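/- Let $n \ge 2$ be an integer and let $BS(1,n) = \langle a, t \mid t a t^{-1} = a^n \rangle$. For a group $G$ and (possibly infinite) generating sets $S, T$ of $G$, write $T \preceq S$ if $\sup_{g \in S} \|g\|_T < \infty$, where $\|\cdot\|_T$ is the word norm with respect to $T$. This is a preorder; let $S \sim T$ mean that $S \preceq T$ and $T \preceq S$, let $[S]$ be the equivalence class of $S$, and order the classes by $[T] \preccurlyeq [S]$ if and only if $T \preceq S$. Let $\mathcal H(G)$ be the poset of those classes $[S]$ for which the Cayley graph $\Gamma(G,S)$ is Gromov hyperbolic. Then $BS(1,n)$ is $\mathcal H$-inaccessible, i.e. the poset $\mathcal H(BS(1,n))$ has no largest element. -/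

import Mathlib

/-! ### Baumslag-Solitar groups -/

/-- The Baumslag-Solitar group `BS(m, k) = ⟨a, t ∣ t a ^ m t⁻¹ = a ^ k⟩`. The generator `0` of the
free group plays the role of `a`, and the generator `1` the role of `t`. -/
abbrev BaumslagSolitar (m k : ℤ) : Type :=
  PresentedGroup
    ({FreeGroup.of 1 * FreeGroup.of 0 ^ m * (FreeGroup.of 1)⁻¹ * (FreeGroup.of 0 ^ k)⁻¹} :
      Set (FreeGroup (Fin 2)))

/-! ### Hyperbolic graphs -/

/-- A connected graph, with its path metric `d`, is (Gromov) hyperbolic if it satisfies the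
four-point condition
`d(x, y) + d(z, w) ≤ max (d(x, z) + d(y, w)) (d(x, w) + d(y, z)) + δ` for some constant `δ`. -/
def SimpleGraph.IsHyperbolic {V : Type*} (Γ : SimpleGraph V) : Prop :=
  Γ.Connected ∧ ∃ δ : ℕ, ∀ x y z w : V,
    Γ.dist x y + Γ.dist z w ≤ max (Γ.dist x z + Γ.dist y w) (Γ.dist x w + Γ.dist y z) + δ

/-! ### Word norms, and the domination preorder on generating sets -/

/-- The word norm of `g` with respect to `S`: the least length of a word in the elements of `S` and
their inverses that represents `g`. It is used only for sets `S` that generate the group. -/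
noncomputable def wordNorm {G : Type*} [Group G] (S : Set G) (g : G) : ℕ :=
  sInf {k : ℕ | ∃ l : List G, l.length = k ∧ (∀ x ∈ l, x ∈ S ∨ x⁻¹ ∈ S) ∧ l.prod = g}

theorem wordNorm_le_length {G : Type*} [Group G] {S : Set G} (l : List G)
    (hl : ∀ x ∈ l, x ∈ S ∨ x⁻¹ ∈ S) : wordNorm S l.prod ≤ l.length :=
  Nat.sInf_le ⟨l, rfl, hl, rfl⟩

theorem exists_word {G : Type*} [Group G] {S : Set G} (hS : Subgroup.closure S = ⊤) (g : G) :
    ∃ l : List G, l.length = wordNorm S g ∧ (∀ x ∈ l, x ∈ S ∨ x⁻¹ ∈ S) ∧ l.prod = g := by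
  have hg : g ∈ Submonoid.closure (S ∪ S⁻¹) := by
    rw [← Subgroup.closure_toSubmonoid, hS]
    trivial
  obtain ⟨l, hl, hp⟩ := Submonoid.exists_list_of_mem_closure hg
  exact Nat.sInf_mem (s := {k : ℕ | ∃ l : List G, l.length = k ∧
    (∀ x ∈ l, x ∈ S ∨ x⁻¹ ∈ S) ∧ l.prod = g}) ⟨l.length, l, rfl, hl, hp⟩

theorem wordNorm_one {G : Type*} [Group G] (S : Set G) : wordNorm S (1 : G) = 0 := by
  simpa using wordNorm_le_length (S := S) ([] : List G) (by simp)

theorem wordNorm_mul_le {G : Type*} [Group G] {S : Set G} (hS : Subgroup.closure S = ⊤) (g h : G) :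
    wordNorm S (g * h) ≤ wordNorm S g + wordNorm S h := by
  obtain ⟨l, hl, hlS, rfl⟩ := exists_word hS g
  obtain ⟨m, hm, hmS, rfl⟩ := exists_word hS h
  rw [← hl, ← hm, ← List.length_append, ← List.prod_append]
  refine wordNorm_le_length _ fun x hx => ?_
  rcases List.mem_append.1 hx with hx | hx
  · exact hlS x hx
  · exact hmS x hx

theorem wordNorm_inv_le {G : Type*} [Group G] {S : Set G} (hS : Subgroup.closure S = ⊤) (g : G) :
    wordNorm S g⁻¹ ≤ wordNorm S g := by
  obtain ⟨l, hl, hlS, rfl⟩ := exists_word hS g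
  rw [← hl, List.prod_inv_reverse]
  refine (wordNorm_le_length _ fun x hx => ?_).trans (by simp)
  simp only [List.mem_reverse, List.mem_map] at hx
  obtain ⟨y, hy, rfl⟩ := hx
  rw [inv_inv]
  exact (hlS y hy).symm

/-- The (possibly infinite) generating sets of the group `G`. -/
def GeneratingSet (G : Type*) [Group G] : Type _ :=
  {S : Set G // Subgroup.closure S = ⊤}

/-- The domination preorder on generating sets: `T ≤ S`, that is, `T` is dominated by `S`, if
`sup_{g ∈ S} ‖g‖_T < ∞`. -/
instance {G : Type*} [Group G] : Preorder (GeneratingSet G) where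
  le T S := ∃ C : ℕ, ∀ g ∈ S.1, wordNorm T.1 g ≤ C
  le_refl S := ⟨1, fun g hg => by
    simpa using wordNorm_le_length (S := S.1) [g] (by simpa using Or.inl hg)⟩
  le_trans T S U := by
    rintro ⟨C, hC⟩ ⟨D, hD⟩
    refine ⟨D * C, fun g hg => ?_⟩
    obtain ⟨l, hl, hlS, rfl⟩ := exists_word S.2 g
    have key : ∀ m : List G, (∀ x ∈ m, x ∈ S.1 ∨ x⁻¹ ∈ S.1) →
        wordNorm T.1 m.prod ≤ m.length * C := by
      intro m
      induction m with
      | nil => intro _; simp [wordNorm_one]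
      | cons x m ih =>
        intro hm
        have hx : wordNorm T.1 x ≤ C := by
          rcases hm x (by simp) with h | h
          · exact hC x h
          · have h1 := wordNorm_inv_le T.2 x⁻¹
            rw [inv_inv] at h1
            exact h1.trans (hC _ h)
        have h2 := ih fun y hy => hm y (List.mem_cons_of_mem _ hy)
        have h3 := wordNorm_mul_le T.2 x m.prod
        rw [List.prod_cons, List.length_cons, Nat.add_mul, Nat.one_mul]
        omega
    refine (key l hlS).trans (Nat.mul_le_mul_right C ?_)
    rw [hl]
    exact hD _ hg

/-! ### The poset of hyperbolic structures -/

/-- The poset of equivalence classes `[S]` of generating sets of `G`, where `S ∼ T` if each of `S`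
and `T` is dominated by the other, with the partial order induced by domination. -/
abbrev GeneratingSetClass (G : Type*) [Group G] : Type _ :=
  Antisymmetrization (GeneratingSet G) (· ≤ ·)

/-- The set `𝓗(G)` of the classes `[S]` of the generating sets `S` of `G` whose Cayley graph
`Γ(G, S)` is hyperbolic. -/
def hyperbolicStructures (G : Type*) [Group G] : Set (GeneratingSetClass G) :=
  {x | ∃ S : GeneratingSet G, (SimpleGraph.mulCayley S.1).IsHyperbolic ∧
    toAntisymmetrization (· ≤ ·) S = x}

/-- `G` is `𝓗`-accessible if the poset `𝓗(G)`, with the order induced from the poset of all classes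
of generating sets, has a largest element. -/
def IsHAccessible (G : Type*) [Group G] : Prop :=
  ∃ x : hyperbolicStructures G, ∀ y : hyperbolicStructures G, y ≤ x

/-! ### Word norms and Cayley graphs -/

/-! `BS(1,n)` acts on `ℚ` with `a` as `y ↦ y + 1` and `t` as `y ↦ n * y`. Each of two absolute
values on `ℚ` yields a hyperbolic structure: the real one, where `t` expands (geometrically the
hyperbolic plane), and the `p`-adic one for a prime `p ∣ n`, where `t⁻¹` expands (geometrically a
tree). In the first, `t ^ k * a * t ^ (-k)` has norm at least `2 * k - 6`; in the second, `t ^ (-k)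
* a * t ^ k` does (`AffineRep.le_wordNorm_conj`).

A largest structure `S` would dominate both, so both conjugates, `u` and `v`, would have `S`-norm
growing linearly in `k`. They commute. By subadditivity there are large `k` with `‖t ^ (2 * k)‖`
close to `2 * ‖t ^ k‖`; then `u` lies in the direction of `t ^ k` and `v^(±1)` in that of `t ^
(-k)`, so both diagonals of the parallelogram `1, u, uv, v` have length close to `‖u‖ + ‖v‖`. Its
sides have lengths `‖u‖` and `‖v‖`, so the four-point condition fails
(`not_isHyperbolic_of_commute_conj`).

Hyperbolicity of the two structures is proved once, in `ScaledLength`: up to a bounded error the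
distance is `2 * level g h - height g - height h`, where `level` is an ultrametric up to 1. -/

theorem wordNorm_inv {G : Type*} [Group G] {S : Set G} (hS : Subgroup.closure S = ⊤) (g : G) :
    wordNorm S g⁻¹ = wordNorm S g :=
  le_antisymm (wordNorm_inv_le hS g) (by simpa using wordNorm_inv_le hS g⁻¹)

theorem wordNorm_pow_le {G : Type*} [Group G] {S : Set G} (hS : Subgroup.closure S = ⊤) (g : G)
    (k : ℕ) : wordNorm S (g ^ k) ≤ k * wordNorm S g := by
  induction k with
  | zero => simp [wordNorm_one]
  | succ k ih =>
    rw [pow_succ, Nat.add_mul, Nat.one_mul]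
    exact (wordNorm_mul_le hS _ _).trans (by omega)

theorem wordNorm_le_one {G : Type*} [Group G] {S : Set G} {g : G} (hg : g ∈ S) :
    wordNorm S g ≤ 1 := by
  simpa using wordNorm_le_length (S := S) [g] (by simpa using Or.inl hg)

/-- Domination is linear: if `T` is dominated by `S`, the word norm of `T` is at most a constant
times that of `S`. -/
theorem GeneratingSet.wordNorm_le_mul {G : Type*} [Group G] {S T : GeneratingSet G} (h : T ≤ S) :
    ∃ C : ℕ, ∀ g, wordNorm T.1 g ≤ C * wordNorm S.1 g := by
  obtain ⟨C, hC⟩ := h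
  refine ⟨C, fun g => ?_⟩
  obtain ⟨l, hl, hlS, rfl⟩ := exists_word S.2 g
  rw [← hl]
  clear hl
  induction l with
  | nil => simp [wordNorm_one]
  | cons x m ih =>
    have hx : wordNorm T.1 x ≤ C := by
      rcases hlS x (by simp) with h | h
      · exact hC x h
      · rw [← wordNorm_inv T.2]
        exact hC _ h
    have h2 := ih fun y hy => hlS y (List.mem_cons_of_mem _ hy)
    have h3 := wordNorm_mul_le T.2 x m.prod
    rw [List.prod_cons, List.length_cons, Nat.mul_add, Nat.mul_one]
    omega

theorem exists_mulCayley_walk {G : Type*} [Group G] {S : Set G} (l : List G)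
    (hl : ∀ x ∈ l, x ∈ S ∨ x⁻¹ ∈ S) (g : G) :
    ∃ p : (SimpleGraph.mulCayley S).Walk g (g * l.prod), p.length ≤ l.length := by
  induction l generalizing g with
  | nil => exact ⟨SimpleGraph.Walk.nil.copy rfl (by simp), by rw [SimpleGraph.Walk.length_copy]; rfl⟩
  | cons x m ih =>
    obtain ⟨p, hp⟩ := ih (fun y hy => hl y (List.mem_cons_of_mem _ hy)) (g * x)
    -- The graph has no loops, so a trivial letter gives no edge; hence only an inequality of
    -- lengths.
    by_cases hx : x = 1
    · subst hx
      refine ⟨p.copy (by simp) (by simp), ?_⟩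
      rw [SimpleGraph.Walk.length_copy, List.length_cons]
      omega
    · have hadj : (SimpleGraph.mulCayley S).Adj g (g * x) := by
        rw [SimpleGraph.mulCayley_adj']
        refine ⟨by simpa using hx, ?_⟩
        rcases hl x (by simp) with h | h
        · exact ⟨x, h, Or.inl rfl⟩
        · exact ⟨x⁻¹, h, Or.inr (by simp)⟩
      exact ⟨(SimpleGraph.Walk.cons hadj p).copy rfl (by simp [mul_assoc]), by simpa using hp⟩

theorem wordNorm_le_length_walk {G : Type*} [Group G] {S : Set G}
    (hS : Subgroup.closure S = ⊤) {g h : G} (p : (SimpleGraph.mulCayley S).Walk g h) :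
    wordNorm S (g⁻¹ * h) ≤ p.length := by
  induction p with
  | nil => simp [wordNorm_one]
  | @cons u v w hadj p ih =>
    have h1 : wordNorm S (u⁻¹ * v) ≤ 1 := by
      rw [SimpleGraph.mulCayley_adj'] at hadj
      obtain ⟨-, x, hx, rfl | rfl⟩ := hadj
      · simpa using wordNorm_le_one hx
      · rw [← wordNorm_inv hS]
        simpa using wordNorm_le_one hx
    have h2 := wordNorm_mul_le hS (u⁻¹ * v) (v⁻¹ * w)
    rw [show u⁻¹ * v * (v⁻¹ * w) = u⁻¹ * w by group] at h2
    rw [SimpleGraph.Walk.length_cons]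
    omega

theorem mulCayley_connected {G : Type*} [Group G] {S : Set G} (hS : Subgroup.closure S = ⊤) :
    (SimpleGraph.mulCayley S).Connected := by
  refine (SimpleGraph.connected_iff _).2 ⟨fun g h => ?_, ⟨1⟩⟩
  obtain ⟨l, -, hl, hp⟩ := exists_word hS (g⁻¹ * h)
  obtain ⟨p, -⟩ := exists_mulCayley_walk l hl g
  exact ⟨p.copy rfl (by simp [hp])⟩

theorem mulCayley_dist {G : Type*} [Group G] {S : Set G} (hS : Subgroup.closure S = ⊤) (g h : G) :
    (SimpleGraph.mulCayley S).dist g h = wordNorm S (g⁻¹ * h) := by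
  apply le_antisymm
  · obtain ⟨l, hl, hlS, hp⟩ := exists_word hS (g⁻¹ * h)
    obtain ⟨p, hpl⟩ := exists_mulCayley_walk l hlS g
    have := SimpleGraph.dist_le (p.copy rfl (by simp [hp] : g * l.prod = h))
    rw [SimpleGraph.Walk.length_copy] at this
    omega
  · obtain ⟨p, hp⟩ := (mulCayley_connected hS).exists_walk_length_eq_dist g h
    rw [← hp]
    exact wordNorm_le_length_walk hS p

/-- The four-point condition for the Cayley graph, in terms of the word norm. -/
theorem isHyperbolic_mulCayley_iff {G : Type*} [Group G] {S : Set G}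
    (hS : Subgroup.closure S = ⊤) :
    (SimpleGraph.mulCayley S).IsHyperbolic ↔ ∃ δ : ℕ, ∀ x y z w : G,
      wordNorm S (x⁻¹ * y) + wordNorm S (z⁻¹ * w) ≤
        max (wordNorm S (x⁻¹ * z) + wordNorm S (y⁻¹ * w))
          (wordNorm S (x⁻¹ * w) + wordNorm S (y⁻¹ * z)) + δ := by
  simp only [SimpleGraph.IsHyperbolic, mulCayley_connected hS, mulCayley_dist hS, true_and]

/-! ### Hyperbolic Cayley graphs from a scaled length function -/

/-- A height homomorphism to `ℤ` together with a length that behaves like the absolute value of the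
translation part of an affine map whose linear part is multiplication by `b ^ height`. -/
structure ScaledLength (G : Type*) [Group G] where
  /-- The scaling factor. -/
  b : ℕ
  /-- The height. -/
  height : G → ℤ
  /-- The length of the translation part. -/
  len : G → ℝ
  /-- An element that acts as multiplication by `b`. -/
  s : G
  two_le : 2 ≤ b
  height_mul : ∀ g h, height (g * h) = height g + height h
  height_s : height s = 1
  len_nonneg : ∀ g, 0 ≤ len g
  len_mul_le : ∀ g h, len (g * h) ≤ len g + (b : ℝ) ^ height g * len h
  len_inv : ∀ g, len g⁻¹ = (b : ℝ) ^ (-height g) * len g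
  len_s : len s = 0

namespace ScaledLength

variable {G : Type*} [Group G] (L : ScaledLength G)

/-- The generating set made of `s` and of the short elements of height zero. -/
def gens : Set G := insert L.s {g | L.height g = 0 ∧ L.len g ≤ 1}

theorem one_lt : 1 < L.b := L.two_le

theorem b_pos : (0 : ℝ) < L.b := by
  have := L.two_le
  positivity

theorem two_le_real : (2 : ℝ) ≤ L.b := by exact_mod_cast L.two_le

theorem height_one : L.height 1 = 0 := by
  have := L.height_mul 1 1
  rw [mul_one] at this
  omega

theorem height_inv (g : G) : L.height g⁻¹ = -L.height g := by
  have := L.height_mul g g⁻¹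
  rw [mul_inv_cancel, height_one] at this
  omega

theorem height_pow (k : ℕ) : L.height (L.s ^ k) = k := by
  induction k with
  | zero => simp [height_one]
  | succ k ih => rw [pow_succ, L.height_mul, ih, L.height_s]; push_cast; rfl

theorem len_one : L.len 1 = 0 := by
  refine le_antisymm ?_ (L.len_nonneg 1)
  have := L.len_mul_le L.s L.s⁻¹
  rwa [mul_inv_cancel, L.len_inv, L.len_s, mul_zero, mul_zero, add_zero] at this

theorem len_pow (k : ℕ) : L.len (L.s ^ k) = 0 := by
  induction k with
  | zero => simp [len_one]
  | succ k ih =>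
    refine le_antisymm ?_ (L.len_nonneg _)
    have := L.len_mul_le (L.s ^ k) L.s
    rwa [ih, L.len_s, mul_zero, add_zero, ← pow_succ] at this

/-- The word made of an ascent by `m`, a short horizontal step, and a descent by `k`. -/
theorem exists_normal_form (g : G) (m k : ℕ) (hmk : L.height g = m - k)
    (hm : L.len g ≤ (L.b : ℝ) ^ m) :
    ∃ q ∈ L.gens, g = L.s ^ m * q * (L.s ^ k)⁻¹ := by
  refine ⟨(L.s ^ m)⁻¹ * g * L.s ^ k, Or.inr ⟨?_, ?_⟩, by group⟩
  · rw [L.height_mul, L.height_mul, L.height_inv, L.height_pow, L.height_pow]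
    omega
  · have h1 := L.len_mul_le ((L.s ^ m)⁻¹ * g) (L.s ^ k)
    have h2 := L.len_mul_le (L.s ^ m)⁻¹ g
    rw [L.len_pow, mul_zero, add_zero] at h1
    rw [L.len_inv, L.len_pow, mul_zero, zero_add, L.height_inv, L.height_pow, zpow_neg,
      zpow_natCast, inv_mul_eq_div] at h2
    refine h1.trans (h2.trans ?_)
    exact (div_le_one (pow_pos L.b_pos m)).2 hm

theorem exists_le_pow (g : G) : ∃ m : ℕ, L.height g ≤ m ∧ L.len g ≤ (L.b : ℝ) ^ m := by
  obtain ⟨m, hm⟩ := pow_unbounded_of_one_lt (L.len g) (by exact_mod_cast L.one_lt : (1 : ℝ) < L.b)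
  -- The ascent must also reach the height of `g`, so that the final descent has a natural exponent.
  refine ⟨max m (L.height g).toNat, by omega, hm.le.trans ?_⟩
  exact pow_le_pow_right₀ (by exact_mod_cast L.one_lt.le) (le_max_left _ _)

theorem closure_gens : Subgroup.closure L.gens = ⊤ := by
  refine (Subgroup.eq_top_iff' _).2 fun g => ?_
  obtain ⟨m, hm, hl⟩ := L.exists_le_pow g
  obtain ⟨q, hq, hg⟩ := L.exists_normal_form g m (m - L.height g).toNat (by omega) hl
  rw [hg]
  have hs : L.s ∈ Subgroup.closure L.gens := Subgroup.subset_closure (Or.inl rfl)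
  exact mul_mem (mul_mem (pow_mem hs _) (Subgroup.subset_closure hq)) (inv_mem (pow_mem hs _))

/-- The normal form spends `m` letters going up, one across and `m - height g` going down. -/
theorem wordNorm_le (g : G) (m : ℕ) (hm : L.height g ≤ m) (hl : L.len g ≤ (L.b : ℝ) ^ m) :
    (wordNorm L.gens g : ℤ) ≤ 2 * m - L.height g + 1 := by
  obtain ⟨q, hq, hg⟩ := L.exists_normal_form g m (m - L.height g).toNat (by omega) hl
  have hs : wordNorm L.gens L.s ≤ 1 := wordNorm_le_one (Or.inl rfl)
  have hpow (k : ℕ) : wordNorm L.gens (L.s ^ k) ≤ k :=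
    (wordNorm_pow_le L.closure_gens _ _).trans (by nlinarith)
  have h1 := wordNorm_mul_le L.closure_gens (L.s ^ m * q) (L.s ^ (m - L.height g).toNat)⁻¹
  have h2 := wordNorm_mul_le L.closure_gens (L.s ^ m) q
  rw [wordNorm_inv L.closure_gens, ← hg] at h1
  have h3 := hpow m
  have h4 := hpow (m - L.height g).toNat
  have h5 := wordNorm_le_one hq
  omega

/-- Multiplication by a generator changes the potential by a bounded factor. -/
theorem potential_mul_le (g x : G) (hx : x ∈ L.gens ∨ x⁻¹ ∈ L.gens) :
    (L.len (g * x) + 3 + 3 * (L.b : ℝ) ^ L.height (g * x)) ^ 2 * (L.b : ℝ) ^ L.height g ≤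
      (L.len g + 3 + 3 * (L.b : ℝ) ^ L.height g) ^ 2 * (L.b : ℝ) ^ L.height (g * x) * L.b := by
  have hb := L.two_le_real
  have hb0 := L.b_pos
  set B : ℝ := (L.b : ℝ) ^ L.height g with hB
  have hB0 : 0 < B := zpow_pos hb0 _
  have hl := L.len_mul_le g x
  have h0 := L.len_nonneg g
  have h0' := L.len_nonneg (g * x)
  rw [← hB] at hl
  have key : ∀ q : G, L.height q = 0 ∧ L.len q ≤ 1 →
      L.height q⁻¹ = 0 ∧ L.len q⁻¹ ≤ 1 := by
    rintro q ⟨h1, h2⟩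
    rw [L.height_inv, L.len_inv, h1]
    simpa using h2
  have horizontal : L.height x = 0 ∧ L.len x ≤ 1 →
    (L.len (g * x) + 3 + 3 * (L.b : ℝ) ^ L.height (g * x)) ^ 2 * B ≤
      (L.len g + 3 + 3 * B) ^ 2 * (L.b : ℝ) ^ L.height (g * x) * L.b := by
    rintro ⟨h1, h2⟩
    rw [L.height_mul, h1, add_zero, ← hB]
    -- A horizontal step adds at most `B` to the length. The coefficient 3 of `B` makes this a
    -- factor `4 / 3`, whose square is below `2 ≤ b`.
    have h3 : L.len (g * x) + 3 + 3 * B ≤ (4 / 3) * (L.len g + 3 + 3 * B) := by nlinarith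
    have h4 : (L.len (g * x) + 3 + 3 * B) ^ 2 ≤ (L.len g + 3 + 3 * B) ^ 2 * L.b := by
      calc _ ≤ ((4 / 3) * (L.len g + 3 + 3 * B)) ^ 2 := by gcongr
        _ = (L.len g + 3 + 3 * B) ^ 2 * (16 / 9) := by ring
        _ ≤ _ := by gcongr; linarith
    calc _ ≤ ((L.len g + 3 + 3 * B) ^ 2 * L.b) * B := by gcongr
      _ = _ := by ring
  rcases hx with (rfl | hx) | (hx | hx)
  · rw [L.height_mul, L.height_s, zpow_add_one₀ hb0.ne', ← hB]
    rw [L.len_s, mul_zero, add_zero] at hl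
    have h3 : L.len (g * L.s) + 3 + 3 * (B * L.b) ≤ (L.len g + 3 + 3 * B) * L.b := by nlinarith
    calc _ ≤ ((L.len g + 3 + 3 * B) * L.b) ^ 2 * B := by gcongr
      _ = _ := by ring
  · exact horizontal hx
  · have hx' : x = L.s⁻¹ := by rw [← hx, inv_inv]
    subst hx'
    rw [L.height_mul, L.height_inv, L.height_s, ← sub_eq_add_neg, zpow_sub_one₀ hb0.ne', ← hB]
    rw [L.len_inv, L.len_s, mul_zero, mul_zero, add_zero] at hl
    have h2 : B * (L.b : ℝ)⁻¹ ≤ B := mul_le_of_le_one_right hB0.le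
      (inv_le_one_of_one_le₀ (by linarith))
    have h3 : B * (L.b : ℝ)⁻¹ * L.b = B := by field_simp
    rw [mul_assoc _ (B * _), h3]
    gcongr
  · exact horizontal (by simpa using key _ hx)

/-- The potential `(len + 3 + 3 * b ^ height) ^ 2 / b ^ height` grows by a factor of at most `b` per
letter. At the identity it is `36 ≤ 2 ^ 6`, whence the 6. This is the lower bound on the norm that
matches `wordNorm_le`. -/
theorem potential_le (g : G) :
    (L.len g + 3 + 3 * (L.b : ℝ) ^ L.height g) ^ 2 ≤
      (L.b : ℝ) ^ (L.height g + wordNorm L.gens g + 6) := by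
  obtain ⟨l, hl, hlS, rfl⟩ := exists_word L.closure_gens g
  rw [← hl]
  clear hl
  have hb := L.two_le_real
  have hb0 := L.b_pos
  induction l using List.reverseRecOn with
  | nil =>
    simp only [List.prod_nil, L.len_one, L.height_one, List.length_nil]
    norm_num
    calc (36 : ℝ) ≤ 2 ^ 6 := by norm_num
      _ ≤ (L.b : ℝ) ^ 6 := by gcongr
      _ = _ := by norm_cast
  | append_singleton l x ih =>
    have h1 := ih fun y hy => hlS y (by simp [hy])
    have h2 := L.potential_mul_le l.prod x (hlS x (by simp))
    rw [List.prod_append, List.prod_singleton, List.length_append, List.length_singleton]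
    set A := (L.len (l.prod * x) + 3 + 3 * (L.b : ℝ) ^ L.height (l.prod * x)) ^ 2
    have hB : 0 < (L.b : ℝ) ^ L.height l.prod := zpow_pos hb0 _
    refine le_of_mul_le_mul_right (h2.trans ?_) hB
    calc _ ≤ (L.b : ℝ) ^ (L.height l.prod + l.length + 6) *
          (L.b : ℝ) ^ L.height (l.prod * x) * L.b := by gcongr
      _ = _ := by
        rw [← zpow_add₀ hb0.ne', ← zpow_add_one₀ hb0.ne', ← zpow_add₀ hb0.ne']
        congr 1
        push_cast
        ring

/-- The least exponent `m` such that `b ^ m` bounds the horizontal distance of `g` and `h` and the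
heights of both. -/
noncomputable def level (g h : G) : ℤ :=
  Int.clog L.b (max (max ((L.b : ℝ) ^ L.height g) ((L.b : ℝ) ^ L.height h))
    ((L.b : ℝ) ^ L.height g * L.len (g⁻¹ * h)))

theorem level_le_iff (g h : G) (m : ℤ) :
    L.level g h ≤ m ↔ (L.height g ≤ m ∧ L.height h ≤ m) ∧
      (L.b : ℝ) ^ L.height g * L.len (g⁻¹ * h) ≤ (L.b : ℝ) ^ m := by
  have h1 : (1 : ℝ) < L.b := by exact_mod_cast L.one_lt
  rw [level, ← Int.le_zpow_iff_clog_le L.one_lt, max_le_iff, max_le_iff,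
    zpow_le_zpow_iff_right₀ h1, zpow_le_zpow_iff_right₀ h1]
  exact lt_max_of_lt_left (lt_max_of_lt_left (zpow_pos L.b_pos _))

theorem level_comm (g h : G) : L.level g h = L.level h g := by
  have h1 : (L.b : ℝ) ^ L.height g * L.len (g⁻¹ * h) =
      (L.b : ℝ) ^ L.height h * L.len (h⁻¹ * g) := by
    rw [show h⁻¹ * g = (g⁻¹ * h)⁻¹ by group, L.len_inv, ← mul_assoc, ← zpow_add₀ L.b_pos.ne',
      L.height_mul, L.height_inv]
    congr 2
    ring
  rw [level, level, h1, max_comm ((L.b : ℝ) ^ L.height g)]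

/-- Horizontal distance satisfies the triangle inequality, and a sum of two terms of size at most `b
^ m` is at most `2 * b ^ m ≤ b ^ (m + 1)`. -/
theorem level_le_max (g h k : G) : L.level g k ≤ max (L.level g h) (L.level h k) + 1 := by
  obtain ⟨⟨h1, h2⟩, h3⟩ := (L.level_le_iff g h _).1 (le_max_left _ (L.level h k))
  obtain ⟨⟨h4, h5⟩, h6⟩ := (L.level_le_iff h k _).1 (le_max_right (L.level g h) _)
  refine (L.level_le_iff _ _ _).2 ⟨⟨by omega, by omega⟩, ?_⟩
  have h7 := L.len_mul_le (g⁻¹ * h) (h⁻¹ * k)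
  rw [show g⁻¹ * h * (h⁻¹ * k) = g⁻¹ * k by group] at h7
  have h8 : (L.b : ℝ) ^ L.height g * (L.b : ℝ) ^ L.height (g⁻¹ * h) = (L.b : ℝ) ^ L.height h := by
    rw [← zpow_add₀ L.b_pos.ne', L.height_mul, L.height_inv]
    congr 1
    ring
  have h9 := mul_le_mul_of_nonneg_left h7 (zpow_pos L.b_pos (L.height g)).le
  rw [mul_add, ← mul_assoc, h8] at h9
  rw [zpow_add_one₀ L.b_pos.ne']
  have h10 := zpow_pos L.b_pos (max (L.level g h) (L.level h k))
  have := L.two_le_real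
  nlinarith

theorem wordNorm_le_level (g h : G) :
    (wordNorm L.gens (g⁻¹ * h) : ℤ) ≤ 2 * L.level g h - L.height g - L.height h + 1 := by
  obtain ⟨⟨h1, h2⟩, h3⟩ := (L.level_le_iff g h _).1 le_rfl
  obtain ⟨m, hm⟩ := Int.eq_ofNat_of_zero_le (sub_nonneg.2 h1)
  have h4 : L.height (g⁻¹ * h) = L.height h - L.height g := by
    rw [L.height_mul, L.height_inv]; ring
  have := L.wordNorm_le (g⁻¹ * h) m (by omega) ?_
  · omega
  · refine le_of_mul_le_mul_left (h3.trans_eq ?_) (zpow_pos L.b_pos (L.height g))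
    rw [← zpow_natCast, ← zpow_add₀ L.b_pos.ne']
    congr 1
    omega

/-- If the level were larger, `potential_le` would bound all three quantities defining it by `b ^
(level - 1)`, against minimality. The 8 is the 6 of `potential_le` plus 2 for lowering the level by
one. -/
theorem level_le_wordNorm (g h : G) :
    2 * L.level g h - L.height g - L.height h ≤ wordNorm L.gens (g⁻¹ * h) + 8 := by
  have h1 := L.potential_le (g⁻¹ * h)
  have h4 : L.height (g⁻¹ * h) = L.height h - L.height g := by
    rw [L.height_mul, L.height_inv]; ring
  rw [h4] at h1
  set N : ℤ := (wordNorm L.gens (g⁻¹ * h) : ℤ)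
  have hb : (1 : ℝ) < L.b := by exact_mod_cast L.one_lt
  have hb0 := L.b_pos
  by_contra! hlt
  have hge : ¬ L.level g h ≤ L.level g h - 1 := by omega
  refine hge ((L.level_le_iff _ _ _).2 ?_)
  have h5 := L.len_nonneg (g⁻¹ * h)
  have h6 : 0 < (L.b : ℝ) ^ (L.height h - L.height g) := zpow_pos hb0 _
  have bound : ∀ y : ℝ, 0 ≤ y →
      y ≤ L.len (g⁻¹ * h) + 3 + 3 * (L.b : ℝ) ^ (L.height h - L.height g) →
      (L.b : ℝ) ^ L.height g * y ≤ (L.b : ℝ) ^ (L.level g h - 1) := by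
    intro y hy0 hy
    have h7 : y ^ 2 ≤ (L.b : ℝ) ^ (L.height h - L.height g + N + 6) :=
      (pow_le_pow_left₀ hy0 hy 2).trans h1
    refine le_of_sq_le_sq ?_ (zpow_pos hb0 _).le
    calc ((L.b : ℝ) ^ L.height g * y) ^ 2 = (L.b : ℝ) ^ (L.height g + L.height g) * y ^ 2 := by
          rw [zpow_add₀ hb0.ne']; ring
      _ ≤ (L.b : ℝ) ^ (L.height g + L.height g) *
          (L.b : ℝ) ^ (L.height h - L.height g + N + 6) := by gcongr
      _ = (L.b : ℝ) ^ (L.height g + L.height h + N + 6) := by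
          rw [← zpow_add₀ hb0.ne']; congr 1; ring
      _ ≤ (L.b : ℝ) ^ (L.level g h - 1 + (L.level g h - 1)) :=
          zpow_le_zpow_right₀ hb.le (by omega)
      _ = _ := by rw [zpow_add₀ hb0.ne']; ring
  refine ⟨⟨?_, ?_⟩, bound _ h5 (by linarith)⟩
  · have := bound 1 zero_le_one (by linarith)
    rwa [mul_one, zpow_le_zpow_iff_right₀ hb] at this
  · have := bound _ h6.le (by linarith)
    rw [← zpow_add₀ hb0.ne', zpow_le_zpow_iff_right₀ hb] at this
    omega

theorem isHyperbolic : (SimpleGraph.mulCayley L.gens).IsHyperbolic := by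
  -- `22 = 2 * 1 + 2 * 8 + 2 * 2`: the errors of two upper bounds, of two lower bounds, and twice
  -- the defect 2 in the four-point inequality for `level`.
  refine (isHyperbolic_mulCayley_iff L.closure_gens).2 ⟨22, fun x y z w => ?_⟩
  have a1 := L.wordNorm_le_level x y
  have a2 := L.wordNorm_le_level z w
  have b1 := L.level_le_wordNorm x z
  have b2 := L.level_le_wordNorm y w
  have b3 := L.level_le_wordNorm x w
  have b4 := L.level_le_wordNorm y z
  have c1 := L.level_le_max x z y
  have c2 := L.level_le_max x w y
  have c3 := L.level_le_max z x w
  have c4 := L.level_le_max z y w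
  rw [L.level_comm z y] at c1 c4
  rw [L.level_comm w y] at c2
  rw [L.level_comm z x] at c3
  omega

theorem le_wordNorm_of_len (g : G) (k : ℕ) (h0 : L.height g = 0) (hk : (L.b : ℝ) ^ k ≤ L.len g) :
    2 * k ≤ wordNorm L.gens g + 6 := by
  have h1 := L.potential_le g
  have hb : (1 : ℝ) < L.b := by exact_mod_cast L.one_lt
  rw [h0] at h1
  have h2 : (L.b : ℝ) ^ ((2 * k : ℕ) : ℤ) ≤ (L.b : ℝ) ^ (0 + (wordNorm L.gens g : ℤ) + 6) := by
    refine le_trans ?_ h1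
    rw [zpow_natCast, mul_comm, pow_mul]
    exact pow_le_pow_left₀ (by have := L.b_pos; positivity) (by norm_num; linarith) 2
  rw [zpow_le_zpow_iff_right₀ hb] at h2
  omega

end ScaledLength

/-! ### An obstruction to hyperbolicity -/

open Filter Topology in
-- By Fekete's lemma `u k / k` converges, and `u (2 * k) / (2 * k)` has the same limit.
theorem Subadditive.exists_two_mul_sub_le {u : ℕ → ℝ} (h : Subadditive u) (h0 : ∀ k, 0 ≤ u k)
    {ε : ℝ} (hε : 0 < ε) (N : ℕ) : ∃ k, N ≤ k ∧ 2 * u k - u (2 * k) ≤ ε * k := by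
  have hbdd : BddBelow (Set.range fun k => u k / k) :=
    ⟨0, by rintro _ ⟨k, rfl⟩; exact div_nonneg (h0 k) k.cast_nonneg⟩
  have h1 := h.tendsto_lim hbdd
  have h2 : Tendsto (fun k => u (2 * k) / (2 * k : ℕ)) atTop (𝓝 h.lim) :=
    h1.comp (tendsto_id.const_mul_atTop' two_pos)
  have h3 : Tendsto (fun k => 2 * (u k / k) - 2 * (u (2 * k) / (2 * k : ℕ))) atTop (𝓝 0) := by
    simpa using (h1.const_mul 2).sub (h2.const_mul 2)
  obtain ⟨k, hk, hkN, hk0⟩ := ((h3.eventually (gt_mem_nhds hε)).and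
    ((eventually_ge_atTop N).and (eventually_gt_atTop 0))).exists
  refine ⟨k, hkN, ?_⟩
  have hk' : (0 : ℝ) < k := by exact_mod_cast hk0
  have h4 : 2 * (u k / k) - 2 * (u (2 * k) / (2 * k : ℕ)) = (2 * u k - u (2 * k)) / k := by
    push_cast
    field_simp
  rw [h4, div_lt_iff₀ hk'] at hk
  exact hk.le

/-- If `t` nearly moves along a geodesic, the conjugates of `a` by `t ^ k` and of `a'` by `t ^ (-k)`
leave the base point in opposite directions. -/
theorem le_wordNorm_conj_inv_mul_conj {G : Type*} [Group G] {S : Set G}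
    (hS : Subgroup.closure S = ⊤) {δ : ℝ}
    (h4 : ∀ x y z w : G, (wordNorm S (x⁻¹ * y) : ℝ) + wordNorm S (z⁻¹ * w) ≤
      max ((wordNorm S (x⁻¹ * z) : ℝ) + wordNorm S (y⁻¹ * w))
        (wordNorm S (x⁻¹ * w) + wordNorm S (y⁻¹ * z)) + δ)
    (a a' p : G) {η : ℝ} (hp : 2 * (wordNorm S p : ℝ) - wordNorm S (p * p) ≤ η)
    (hu : wordNorm S a + η + δ < wordNorm S (p * a * p⁻¹))
    (hv : wordNorm S a' + η + 2 * δ < wordNorm S (p⁻¹ * a' * p)) :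
    (wordNorm S (p * a * p⁻¹) : ℝ) + wordNorm S (p⁻¹ * a' * p) - η - 2 * δ ≤
      wordNorm S ((p * a * p⁻¹)⁻¹ * (p⁻¹ * a' * p)) := by
  have hm (g h : G) : (wordNorm S (g * h) : ℝ) ≤ wordNorm S g + wordNorm S h := by
    exact_mod_cast wordNorm_mul_le hS g h
  have hap := hm a p⁻¹
  have hap' := hm a' p
  rw [wordNorm_inv hS] at hap
  -- The point `p * a * p⁻¹` is far from `p⁻¹`: in the four-point condition with `1, p, p⁻¹`, the
  -- other pairing is excluded by `hu`, its distance to `p` being at most `‖a‖ + ‖p‖`.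
  have hQU : (wordNorm S (p * a * p⁻¹) : ℝ) + wordNorm S p - η - δ ≤
      wordNorm S (p * (p * a * p⁻¹)) := by
    have h := h4 1 (p * a * p⁻¹) p p⁻¹
    rw [show p⁻¹ * p⁻¹ = (p * p)⁻¹ by group,
      show (p * a * p⁻¹)⁻¹ * p⁻¹ = (p * (p * a * p⁻¹))⁻¹ by group,
      show (p * a * p⁻¹)⁻¹ * p = (a * p⁻¹)⁻¹ by group, inv_one, one_mul, one_mul, one_mul,
      wordNorm_inv hS (p * p), wordNorm_inv hS (p * (p * a * p⁻¹)), wordNorm_inv hS (a * p⁻¹),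
      wordNorm_inv hS p] at h
    rcases le_total ((wordNorm S p : ℝ) + wordNorm S (p * (p * a * p⁻¹)))
      (wordNorm S p + wordNorm S (a * p⁻¹)) with h' | h'
    · rw [max_eq_right h'] at h
      linarith
    · rw [max_eq_left h'] at h
      linarith
  -- The same argument at the other end: `p⁻¹ * a' * p` is close to the direction of `p⁻¹`, and `hv`
  -- excludes the other pairing.
  have h := h4 1 (p⁻¹ * a' * p) p⁻¹ (p * a * p⁻¹)
  rw [show (p⁻¹ * a' * p)⁻¹ * (p * a * p⁻¹) = ((p * a * p⁻¹)⁻¹ * (p⁻¹ * a' * p))⁻¹ by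
      simp only [mul_inv_rev, inv_inv],
    show (p⁻¹ * a' * p)⁻¹ * p⁻¹ = (a' * p)⁻¹ by group, inv_one, one_mul, one_mul, one_mul, inv_inv,
    wordNorm_inv hS ((p * a * p⁻¹)⁻¹ * _), wordNorm_inv hS (a' * p), wordNorm_inv hS p] at h
  rcases le_total ((wordNorm S p : ℝ) + wordNorm S ((p * a * p⁻¹)⁻¹ * (p⁻¹ * a' * p)))
    (wordNorm S (p * a * p⁻¹) + wordNorm S (a' * p)) with h' | h'
  · rw [max_eq_right h'] at h
    linarith
  · rw [max_eq_left h'] at h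
    linarith

/-- A Cayley graph is not hyperbolic if the conjugates of `a` by `t ^ k` and by `t ^ (-k)` commute
and both have linearly growing norm. -/
theorem not_isHyperbolic_of_commute_conj {G : Type*} [Group G] {S : Set G}
    (hS : Subgroup.closure S = ⊤) (a t : G)
    (hcomm : ∀ k : ℕ, Commute (t ^ k * a * (t ^ k)⁻¹) ((t ^ k)⁻¹ * a * t ^ k)) (C D : ℕ)
    (hu : ∀ k : ℕ, k ≤ C * wordNorm S (t ^ k * a * (t ^ k)⁻¹) + D)
    (hv : ∀ k : ℕ, k ≤ C * wordNorm S ((t ^ k)⁻¹ * a * t ^ k) + D) :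
    ¬ (SimpleGraph.mulCayley S).IsHyperbolic := by
  intro hyp
  obtain ⟨δ, hδ⟩ := (isHyperbolic_mulCayley_iff hS).1 hyp
  have h4 : ∀ x y z w : G, (wordNorm S (x⁻¹ * y) : ℝ) + wordNorm S (z⁻¹ * w) ≤
      max ((wordNorm S (x⁻¹ * z) : ℝ) + wordNorm S (y⁻¹ * w))
        (wordNorm S (x⁻¹ * w) + wordNorm S (y⁻¹ * z)) + δ := by
    intro x y z w
    exact_mod_cast hδ x y z w
  have hδ0 : (0 : ℝ) ≤ δ := δ.cast_nonneg
  have hsub : Subadditive fun k => (wordNorm S (t ^ k) : ℝ) := by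
    intro m k
    simp only [pow_add]
    exact_mod_cast wordNorm_mul_le hS _ _
  -- With this `ε`, the error `η` times `C + 1` is `k / 2`; the lower bound on `k` chosen next
  -- absorbs the constants in the other half. `C + 1` avoids division by zero.
  have hε : (0 : ℝ) < 1 / (2 * (C + 1)) := by positivity
  obtain ⟨k, hk, hkε⟩ := hsub.exists_two_mul_sub_le (fun _ => Nat.cast_nonneg _) hε
    (2 * ((C + 1) * (wordNorm S a + 3 * δ + 1) + D))
  set p := t ^ k with hp
  rw [two_mul k, pow_add, ← hp] at hkε
  set η : ℝ := 1 / (2 * (C + 1)) * k with hη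
  have hηk : 2 * (C + 1) * η = k := by rw [hη]; field_simp
  have large (f : ℕ) (hf : k ≤ C * f + D) : (wordNorm S a : ℝ) + η + 3 * δ + 1 ≤ f := by
    have h1 : (k : ℝ) ≤ C * f + D := by exact_mod_cast hf
    have h2 : 2 * (((C : ℝ) + 1) * (wordNorm S a + 3 * δ + 1) + D) ≤ k := by exact_mod_cast hk
    have h3 : (0 : ℝ) ≤ f := f.cast_nonneg
    have h5 : ((C : ℝ) + 1) * (wordNorm S a + η + 3 * δ + 1) ≤ (C + 1) * f := by nlinarith
    exact le_of_mul_le_mul_left h5 (by positivity)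
  have hu' := large _ (hu k)
  have hv' := large _ (hv k)
  have hui : p * a⁻¹ * p⁻¹ = (p * a * p⁻¹)⁻¹ := by group
  have e1 := le_wordNorm_conj_inv_mul_conj hS h4 a a p hkε (by linarith) (by linarith)
  -- Replacing `a` by `a⁻¹` replaces `u` by `u⁻¹`, which bounds the other diagonal `‖u * v‖`.
  have e2 := le_wordNorm_conj_inv_mul_conj hS h4 a⁻¹ a p hkε
    (by rw [hui, wordNorm_inv hS, wordNorm_inv hS]; linarith) (by linarith)
  rw [hui, wordNorm_inv hS, inv_inv] at e2
  have hc := hcomm k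
  rw [← hp] at hc hu' hv'
  generalize p * a * p⁻¹ = u at *
  generalize p⁻¹ * a * p = v at *
  -- Commutativity makes the sides opposite to `u` and `v` have the same lengths `‖u‖` and `‖v‖`.
  have h := h4 1 (u * v) u v
  rw [show (u * v)⁻¹ * v = u⁻¹ by rw [hc.eq]; group, show (u * v)⁻¹ * u = v⁻¹ by group,
    wordNorm_inv hS u, wordNorm_inv hS v, inv_one, one_mul, one_mul, one_mul] at h
  rcases max_choice ((wordNorm S u : ℝ) + wordNorm S u) (wordNorm S v + wordNorm S v) with h' | h'
  · rw [h'] at h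
    have : (0 : ℝ) ≤ wordNorm S a := Nat.cast_nonneg _
    linarith
  · rw [h'] at h
    have : (0 : ℝ) ≤ wordNorm S a := Nat.cast_nonneg _
    linarith

/-! ### Affine representations -/

/-- A representation of `G` by the affine maps `y ↦ n ^ height g * y + trans g` of `ℚ`. -/
structure AffineRep (G : Type*) [Group G] (n : ℕ) where
  /-- The exponent of the linear part. -/
  height : G → ℤ
  /-- The translation part. -/
  trans : G → ℚ
  height_mul : ∀ g h, height (g * h) = height g + height h
  trans_mul : ∀ g h, trans (g * h) = trans g + (n : ℚ) ^ height g * trans h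

namespace AffineRep

variable {G : Type*} [Group G] {n : ℕ} (A : AffineRep G n)

theorem height_one : A.height 1 = 0 := by
  have := A.height_mul 1 1
  rw [mul_one] at this
  omega

theorem height_inv (g : G) : A.height g⁻¹ = -A.height g := by
  have := A.height_mul g g⁻¹
  rw [mul_inv_cancel, height_one] at this
  omega

theorem trans_one : A.trans 1 = 0 := by
  have := A.trans_mul 1 1
  rw [mul_one, height_one, zpow_zero, one_mul] at this
  linarith

theorem trans_inv (g : G) : A.trans g⁻¹ = -((n : ℚ) ^ (-A.height g) * A.trans g) := by
  have := A.trans_mul g⁻¹ g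
  rw [inv_mul_cancel, trans_one, height_inv] at this
  linarith

theorem height_pow (g : G) (k : ℕ) : A.height (g ^ k) = k * A.height g := by
  induction k with
  | zero => simp [height_one]
  | succ k ih => rw [pow_succ, A.height_mul, ih]; push_cast; ring

theorem trans_pow_eq_zero {g : G} (hg : A.trans g = 0) (k : ℕ) : A.trans (g ^ k) = 0 := by
  induction k with
  | zero => simp [trans_one]
  | succ k ih => rw [pow_succ, A.trans_mul, ih, hg]; simp

theorem height_conj (g h : G) : A.height (g * h * g⁻¹) = A.height h := by
  rw [A.height_mul, A.height_mul, A.height_inv]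
  ring

theorem trans_conj {g h : G} (hg : A.trans g = 0) :
    A.trans (g * h * g⁻¹) = (n : ℚ) ^ A.height g * A.trans h := by
  rw [A.trans_mul, A.trans_mul, A.trans_inv, hg]
  ring

/-- The scaled length given by an absolute value on `ℚ` for which `n` has size `b` or `b⁻¹`. -/
def scaledLength (ν : AbsoluteValue ℚ ℝ) {b : ℕ} (hb : 2 ≤ b) {e : ℤ} (he : e * e = 1)
    (hν : ν n = (b : ℝ) ^ e) (s : G) (hs : A.height s = e) (hs0 : A.trans s = 0) :
    ScaledLength G where
  b := b
  height g := e * A.height g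
  len g := ν (A.trans g)
  s := s
  two_le := hb
  height_mul g h := by rw [A.height_mul, mul_add]
  height_s := by rw [hs, he]
  len_nonneg g := ν.nonneg _
  len_mul_le g h := by
    rw [A.trans_mul, zpow_mul, ← hν, ← map_zpow₀, ← map_mul]
    exact ν.add_le _ _
  len_inv g := by
    rw [A.trans_inv, ν.map_neg, map_mul, map_zpow₀, hν, ← zpow_mul, mul_neg]
  len_s := by rw [hs0, map_zero]

/-- The size of the conjugates of `a` by powers of `s`. -/
theorem le_wordNorm_conj (ν : AbsoluteValue ℚ ℝ) {b : ℕ} (hb : 2 ≤ b) {e : ℤ} (he : e * e = 1)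
    (hν : ν n = (b : ℝ) ^ e) (s : G) (hs : A.height s = e) (hs0 : A.trans s = 0) {a : G}
    (ha : A.height a = 0) (ha1 : A.trans a = 1) (k : ℕ) :
    2 * k ≤ wordNorm (A.scaledLength ν hb he hν s hs hs0).gens (s ^ k * a * (s ^ k)⁻¹) + 6 := by
  refine (A.scaledLength ν hb he hν s hs hs0).le_wordNorm_of_len _ k ?_ ?_
  · change e * A.height _ = 0
    rw [A.height_conj, ha, mul_zero]
  · change (b : ℝ) ^ k ≤ ν (A.trans _)
    rw [A.trans_conj (A.trans_pow_eq_zero hs0 k), ha1, mul_one, A.height_pow, hs, map_zpow₀, hν,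
      ← zpow_mul, mul_left_comm, he, mul_one, zpow_natCast]

end AffineRep

/-- A group with a largest hyperbolic structure cannot have an affine representation in which two
absolute values see the element `t` expand and contract. -/
theorem AffineRep.not_isHAccessible {G : Type*} [Group G] {n : ℕ} (A : AffineRep G n)
    (ν ν' : AbsoluteValue ℚ ℝ) {b b' : ℕ} (hb : 2 ≤ b) (hb' : 2 ≤ b') (hν : ν n = b)
    (hν' : ν' n = (b' : ℝ)⁻¹) (a t : G) (ha : A.height a = 0) (ha1 : A.trans a = 1)
    (ht : A.height t = 1) (ht0 : A.trans t = 0)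
    (hcomm : ∀ k : ℕ, Commute (t ^ k * a * (t ^ k)⁻¹) ((t ^ k)⁻¹ * a * t ^ k)) :
    ¬ IsHAccessible G := by
  rintro ⟨⟨_, S, hyp, rfl⟩, hx⟩
  have hν1 : ν n = (b : ℝ) ^ (1 : ℤ) := by simpa using hν
  have hν1' : ν' n = (b' : ℝ) ^ (-1 : ℤ) := by simpa using hν'
  have ht' : A.height t⁻¹ = -1 := by rw [A.height_inv, ht]
  have ht0' : A.trans t⁻¹ = 0 := by rw [A.trans_inv, ht0]; simp
  have dom (L : ScaledLength G) : ∃ C : ℕ, ∀ g, wordNorm L.gens g ≤ C * wordNorm S.1 g := by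
    have h := hx ⟨toAntisymmetrization (· ≤ ·) (⟨L.gens, L.closure_gens⟩ : GeneratingSet G),
      ⟨_, L.isHyperbolic, rfl⟩⟩
    exact GeneratingSet.wordNorm_le_mul (S := S) (T := ⟨L.gens, L.closure_gens⟩) h
  obtain ⟨C, hC⟩ := dom (A.scaledLength ν hb (one_mul 1) hν1 t ht ht0)
  obtain ⟨C', hC'⟩ := dom (A.scaledLength ν' hb' (by norm_num) hν1' t⁻¹ ht' ht0')
  -- The real structure controls the conjugates by `t ^ k`, the other those by `t ^ (-k)`; the sum
  -- `C + C'` serves both.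
  refine not_isHyperbolic_of_commute_conj S.2 a t hcomm (C + C') 6 (fun k => ?_) (fun k => ?_) hyp
  · have h1 := A.le_wordNorm_conj ν hb (one_mul 1) hν1 t ht ht0 ha ha1 k
    have h2 := hC (t ^ k * a * (t ^ k)⁻¹)
    rw [add_mul]
    omega
  · have h1 := A.le_wordNorm_conj ν' hb' (by norm_num) hν1' t⁻¹ ht' ht0' ha ha1 k
    have h2 := hC' ((t ^ k)⁻¹ * a * t ^ k)
    rw [inv_pow, inv_inv] at h1
    rw [add_mul]
    omega

/-! ### The Baumslag-Solitar groups `BS(1, n)` -/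

namespace BaumslagSolitar

/-- The standard generator `a`. -/
def a (m k : ℤ) : BaumslagSolitar m k := PresentedGroup.of 0

/-- The standard generator `t`. -/
def t (m k : ℤ) : BaumslagSolitar m k := PresentedGroup.of 1

theorem t_mul_a_zpow_mul_t_inv (m k : ℤ) : t m k * a m k ^ m * (t m k)⁻¹ = a m k ^ k := by
  have h := PresentedGroup.one_of_mem (Set.mem_singleton (FreeGroup.of (1 : Fin 2) *
    FreeGroup.of 0 ^ m * (FreeGroup.of 1)⁻¹ * (FreeGroup.of 0 ^ k)⁻¹))
  rw [map_mul, map_mul, map_mul, map_inv, map_inv, map_zpow, map_zpow] at h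
  exact mul_inv_eq_one.1 h

theorem pow_conj (n k : ℕ) :
    t 1 n ^ k * a 1 n * (t 1 n ^ k)⁻¹ = a 1 n ^ n ^ k := by
  have h1 := t_mul_a_zpow_mul_t_inv 1 n
  simp only [zpow_one, zpow_natCast] at h1
  induction k with
  | zero => simp
  | succ k ih =>
    rw [pow_succ', show t 1 n * t 1 n ^ k * a 1 n * (t 1 n * t 1 n ^ k)⁻¹ =
      t 1 n * (t 1 n ^ k * a 1 n * (t 1 n ^ k)⁻¹) * (t 1 n)⁻¹ by group, ih, ← conj_pow, h1,
      ← pow_mul, pow_succ']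

theorem commute_conj (n k : ℕ) : Commute (t 1 n ^ k * a 1 n * (t 1 n ^ k)⁻¹)
    ((t 1 n ^ k)⁻¹ * a 1 n * t 1 n ^ k) := by
  -- Conjugated by `t ^ k`, the pair becomes a power of `a` and `a` itself.
  have h : Commute (t 1 n ^ (k + k) * a 1 n * (t 1 n ^ (k + k))⁻¹) (a 1 n) := by
    rw [pow_conj]
    exact (Commute.refl _).pow_left _
  have h2 := (h.map (MulAut.conj (t 1 n ^ k)⁻¹).toMonoidHom)
  simp only [MulEquiv.coe_toMonoidHom, MulAut.conj_apply, inv_inv] at h2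
  rw [pow_add] at h2
  convert h2 using 1
  group

/-- The height homomorphism of `BS(1, n)`. -/
def heightHom (n : ℕ) : BaumslagSolitar 1 n →* Multiplicative ℤ :=
  PresentedGroup.toGroup (f := ![1, Multiplicative.ofAdd 1]) (by simp)

/-- The affine action of `BS(1, n)` on `ℚ`. -/
def affineHom {n : ℕ} (hn : n ≠ 0) : BaumslagSolitar 1 n →* Equiv.Perm ℚ :=
  PresentedGroup.toGroup (f := ![Equiv.addLeft 1, Equiv.mulLeft₀ (n : ℚ) (by exact_mod_cast hn)])
    (by
      rintro _ rfl
      simp only [map_mul, map_inv, FreeGroup.lift_apply_of, mul_inv_eq_one, zpow_one,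
        zpow_natCast]
      rw [mul_inv_eq_iff_eq_mul]
      ext y
      simp [mul_add])

/-- The elements acting affinely with the slope given by the height form a subgroup containing both
generators. -/
theorem affineHom_apply {n : ℕ} (hn : n ≠ 0) (g : BaumslagSolitar 1 n) (y : ℚ) :
    affineHom hn g y =
      affineHom hn g 0 + (n : ℚ) ^ (Multiplicative.toAdd (heightHom n g)) * y := by
  have hn' : (n : ℚ) ≠ 0 := by exact_mod_cast hn
  let K : Subgroup (BaumslagSolitar 1 n) :=
    { carrier := {g | ∀ y : ℚ, affineHom hn g y =
        affineHom hn g 0 + (n : ℚ) ^ (Multiplicative.toAdd (heightHom n g)) * y}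
      one_mem' := by simp
      mul_mem' := by
        intro g h hg hh y
        rw [map_mul, map_mul, Equiv.Perm.mul_apply, Equiv.Perm.mul_apply, hh y,
          hg (affineHom hn h 0), hg (affineHom hn h 0 + _), toAdd_mul, zpow_add₀ hn']
        ring
      inv_mem' := by
        intro g hg y
        have h1 := hg (affineHom hn g⁻¹ y)
        have h2 := hg (affineHom hn g⁻¹ 0)
        rw [← Equiv.Perm.mul_apply, ← map_mul, mul_inv_cancel, map_one, Equiv.Perm.one_apply]
          at h1 h2
        have h3 := zpow_ne_zero (Multiplicative.toAdd (heightHom n g)) hn'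
        rw [map_inv (heightHom n), toAdd_inv, zpow_neg]
        field_simp
        linarith }
  refine PresentedGroup.generated_by _ K (fun j => ?_) g y
  intro y
  fin_cases j <;> simp [affineHom, heightHom]

/-- The affine representation of `BS(1, n)` on `ℚ`. -/
def affineRep {n : ℕ} (hn : n ≠ 0) : AffineRep (BaumslagSolitar 1 n) n where
  height g := Multiplicative.toAdd (heightHom n g)
  trans g := affineHom hn g 0
  height_mul g h := by rw [map_mul, toAdd_mul]
  trans_mul g h := by rw [map_mul, Equiv.Perm.mul_apply, affineHom_apply]

end BaumslagSolitar

theorem mainTheorem2 (n : ℕ) (hn : 2 ≤ n) :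
    ¬ IsHAccessible (BaumslagSolitar 1 (n : ℤ)) := by
  have hn0 : n ≠ 0 := by omega
  obtain ⟨p, hp, hpn⟩ := Nat.exists_prime_and_dvd (show n ≠ 1 by omega)
  have : Fact p.Prime := ⟨hp⟩
  have hv : 1 ≤ padicValNat p n := one_le_padicValNat_of_dvd hn0 hpn
  -- One prime divisor `p` of `n` is enough: `n` has `p`-adic size `(p ^ padicValNat p n)⁻¹`,
  -- whatever its other prime factors.
  refine (BaumslagSolitar.affineRep hn0).not_isHAccessible Rat.AbsoluteValue.real
    (Rat.AbsoluteValue.padic p) (b' := p ^ padicValNat p n) hn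
    (hp.two_le.trans (Nat.le_self_pow (by omega) p)) ?_ ?_
    (BaumslagSolitar.a 1 n) (BaumslagSolitar.t 1 n) ?_ ?_ ?_ ?_ (BaumslagSolitar.commute_conj n)
  · simp
  · rw [Rat.AbsoluteValue.padic_eq_padicNorm, padicNorm.eq_zpow_of_nonzero (by exact_mod_cast hn0)]
    simp
  all_goals
    simp [BaumslagSolitar.affineRep, BaumslagSolitar.heightHom, BaumslagSolitar.affineHom,
      BaumslagSolitar.a, BaumslagSolitar.t]
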